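/- Let $\Gamma$ be a finite non-empty simplicial graph (that is, a finite simple undirected graph) with vertex set $V(\Gamma)$ and edge set $E(\Gamma)$, let $$A(\Gamma)=\langle V(\Gamma)\mid [v,w]=1 \text{ for all } \{v,w\}\in E(\Gamma)\rangle$$ be the right-angled Artin group on $\Gamma$, and let $F$ be a field. Set $V=H^1(A(\Gamma),F)$ and $W=H^2(A(\Gamma),F)$ (group cohomology with trivial coefficients $F$), and let $q\colon V\times V\to W$ be the cup product pairing. Then $\Gamma$ admits a Hamiltonian path, i.e. a path that visits every vertex exactly once, if and only if $(V,W,q)$ is Hamiltonian. Here $(V,W,q)$ is called Hamiltonian if $V$ is finite dimensional and for every basis $\{w_1,\ldots,w_n\}$ of $V$ there is a permutation $\sigma\in S_n$ such that $q(w_{\sigma(i)},w_{\sigma(i+1)})\neq 0$ for all $1\le i<n$. -/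

import Mathlib

open CategoryTheory

universe u

/-- The right-angled Artin group of a simplicial graph: one generator for every vertex and the
relation `[v, w] = 1` for every edge `{v, w}`. -/
abbrev RightAngledArtinGroup {V : Type*} (Γ : SimpleGraph V) : Type _ :=
  PresentedGroup
    {r : FreeGroup V | ∃ v w : V, Γ.Adj v w ∧
      r = FreeGroup.of v * FreeGroup.of w * (FreeGroup.of v)⁻¹ * (FreeGroup.of w)⁻¹}

namespace CupProduct

variable {k G : Type u} [CommRing k] [Group G]

/-- The cross product `(g, h) ↦ a g * b h` of two `1`-cocycles with trivial coefficients `k` is a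
`2`-cocycle. -/
theorem mul_mem_cocycles₂ (a b : groupCohomology.cocycles₁ (Rep.trivial k G k)) :
    (fun p : G × G => (a p.1 * b p.2 : k)) ∈ groupCohomology.cocycles₂ (Rep.trivial k G k) := by
  rw [groupCohomology.mem_cocycles₂_iff]
  intro g h j
  simp only [groupCohomology.cocycles₁_map_mul_of_isTrivial]
  change (a g + a h : k) * b j + a g * b h = a h * b j + a g * (b h + b j)
  ring

/-- The cup product of `1`-cocycles with trivial coefficients, as a bilinear map to `2`-cocycles:
`(a ⌣ b) (g, h) = a g * b h`. -/
noncomputable def cocyclesCup :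
    groupCohomology.cocycles₁ (Rep.trivial k G k) →ₗ[k]
      groupCohomology.cocycles₁ (Rep.trivial k G k) →ₗ[k]
        groupCohomology.cocycles₂ (Rep.trivial k G k) :=
  LinearMap.mk₂ k (fun a b => ⟨fun p : G × G => (a p.1 * b p.2 : k), mul_mem_cocycles₂ a b⟩)
    (fun a a' b => Subtype.ext <| funext fun p => add_mul (a p.1 : k) (a' p.1) (b p.2))
    (fun c a b => Subtype.ext <| funext fun p => mul_assoc c (a p.1 : k) (b p.2))
    (fun a b b' => Subtype.ext <| funext fun p => mul_add (a p.1 : k) (b p.2) (b' p.2))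
    (fun c a b => Subtype.ext <| funext fun p => mul_left_comm (a p.1 : k) c (b p.2))

/-- Every class in `H¹(G, k)` with trivial coefficients is represented by a unique `1`-cocycle. -/
noncomputable def cocycleOfH1 :
    groupCohomology.H1 (Rep.trivial k G k) →ₗ[k]
      groupCohomology.cocycles₁ (Rep.trivial k G k) :=
  ((groupCohomology.H1IsoOfIsTrivial (Rep.trivial k G k)).hom ≫
    (groupCohomology.cocycles₁IsoOfIsTrivial (Rep.trivial k G k)).inv).hom

/-- The cup product pairing `H¹(G, k) × H¹(G, k) → H²(G, k)` in group cohomology with trivial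
coefficients: the class of `a` and the class of `b` are sent to the class of `a ⌣ b`. -/
noncomputable def cup :
    groupCohomology.H1 (Rep.trivial k G k) →ₗ[k] groupCohomology.H1 (Rep.trivial k G k) →ₗ[k]
      groupCohomology.H2 (Rep.trivial k G k) :=
  (cocyclesCup.compl₁₂ cocycleOfH1 cocycleOfH1).compr₂
    (groupCohomology.H2π (Rep.trivial k G k)).hom

/-- The chosen representative of the class of a `1`-cocycle is that cocycle. -/
theorem cocycleOfH1_H1π (a : groupCohomology.cocycles₁ (Rep.trivial k G k)) :
    cocycleOfH1 (groupCohomology.H1π (Rep.trivial k G k) a) = a := by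
  apply groupCohomology.cocycles₁_ext
  intro g
  exact groupCohomology.H1IsoOfIsTrivial_H1π_apply_apply a (Additive.ofMul g)

/-- The cup product of the classes of two `1`-cocycles is the class of their cup product. -/
theorem cup_H1π (a b : groupCohomology.cocycles₁ (Rep.trivial k G k)) :
    cup (groupCohomology.H1π (Rep.trivial k G k) a) (groupCohomology.H1π (Rep.trivial k G k) b) =
      groupCohomology.H2π (Rep.trivial k G k)
        ⟨fun p : G × G => (a p.1 * b p.2 : k), mul_mem_cocycles₂ a b⟩ := by
  have h : cup (groupCohomology.H1π (Rep.trivial k G k) a)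
      (groupCohomology.H1π (Rep.trivial k G k) b) =
      groupCohomology.H2π (Rep.trivial k G k)
        (cocyclesCup (cocycleOfH1 (groupCohomology.H1π (Rep.trivial k G k) a))
          (cocycleOfH1 (groupCohomology.H1π (Rep.trivial k G k) b))) := rfl
  rw [h, cocycleOfH1_H1π, cocycleOfH1_H1π]
  rfl

end CupProduct

/-- A bilinear pairing `q : V × V → W` on a finite-dimensional vector space is Hamiltonian if every
basis of `V` can be permuted so that `q` is nonzero on any two consecutive basis vectors. -/
def IsHamiltonianPairing {F V W : Type*} [Field F] [AddCommGroup V] [Module F V]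
    [AddCommGroup W] [Module F W] (q : V →ₗ[F] V →ₗ[F] W) : Prop :=
  FiniteDimensional F V ∧
    ∀ (n : ℕ) (w : Module.Basis (Fin n) F V), ∃ σ : Equiv.Perm (Fin n),
      ∀ (i : ℕ) (h : i + 1 < n),
        q (w (σ ⟨i, Nat.lt_of_succ_lt h⟩)) (w (σ ⟨i + 1, h⟩)) ≠ 0

/-!
Classes in `H¹(A(Γ), F)` are functions on the vertices. In these coordinates, `f ⌣ g = 0` iff
`f v * g w = f w * g v` for every edge `{v, w}` (`RightAngledArtinGroup.cup_eq_zero_iff`). Indeed,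
if `f ⌣ g` is the coboundary of a function, then `f x * g y` is symmetric in commuting elements
`x`, `y`. Conversely, the condition says that the Heisenberg matrices `(f v, g v, 0)` commute along
edges, so that they define a homomorphism from `A(Γ)` to the Heisenberg group, whose corner entry
exhibits `f ⌣ g` as a coboundary.

If the pairing is Hamiltonian, the ordering of the basis of coordinate vectors is a Hamiltonian path.

For the other direction, number the vertices along a Hamiltonian path and write a basis as the rows
of a nonsingular matrix `A`. It suffices to order the rows so that any two consecutive ones have a
nonzero `2 × 2` minor on two consecutive columns (`exists_perm_linked`). If a row vanishes at a column
but not on either side of it, it is the sum of its two parts, and the determinant stays nonzero when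
the row is replaced by one of them; this creates no new nonzero minors. So all rows may be assumed to
be supported on intervals. Some term `∏ i, A (σ i) i` of the determinant is nonzero. If the rows
`σ i` and `σ (i + 1)` had no nonzero consecutive minor, then, as their supports are intervals
containing `i` and `i + 1`, they would be proportional, which is impossible.
-/

/-! ### Matrices and consecutive minors -/

/-- Two vectors are *linked* if one of their `2 × 2` minors on two consecutive coordinates is nonzero;
for the path graph this says that the cup product of the corresponding classes is nonzero. -/
def ConsecutivelyLinked {F : Type*} [Field F] {n : ℕ} (f g : Fin n → F) : Prop :=
  ∃ (j : ℕ) (h : j + 1 < n),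
    f ⟨j, Nat.lt_of_succ_lt h⟩ * g ⟨j + 1, h⟩ ≠ f ⟨j + 1, h⟩ * g ⟨j, Nat.lt_of_succ_lt h⟩

/-- The support of `f` is an interval (possibly empty): a zero of `f` does not have nonzero values on
both sides. -/
def HasIntervalSupport {F : Type*} [Field F] {n : ℕ} (f : Fin n → F) : Prop :=
  ∀ k, f k = 0 → (∀ j < k, f j = 0) ∨ (∀ j, k < j → f j = 0)

section Linked

variable {F : Type*} [Field F] {n : ℕ}

theorem ConsecutivelyLinked.symm {f g : Fin n → F} (h : ConsecutivelyLinked f g) :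
    ConsecutivelyLinked g f := by
  obtain ⟨j, hj, h⟩ := h
  exact ⟨j, hj, fun h' => h (by linear_combination -h')⟩

/-- Cutting `f` at one of its zeros and keeping the left part creates no new links. -/
theorem ConsecutivelyLinked.of_restrict_lt {f g : Fin n → F} {k : Fin n} (hk : f k = 0)
    (h : ConsecutivelyLinked (fun j => if j < k then f j else 0) g) :
    ConsecutivelyLinked f g := by
  obtain ⟨j, hj, h⟩ := h
  refine ⟨j, hj, fun h' => h ?_⟩
  have hk' (hjk : j + 1 = k) : f ⟨j + 1, hj⟩ = 0 := by rw [← hk]; congr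
  simp only [Fin.lt_def]
  split_ifs with h1 h2 h2
  · exact h'
  · rw [h', hk' (by omega)]
  · omega
  · simp

/-- Cutting `f` at one of its zeros and keeping the right part creates no new links. -/
theorem ConsecutivelyLinked.of_restrict_gt {f g : Fin n → F} {k : Fin n} (hk : f k = 0)
    (h : ConsecutivelyLinked (fun j => if k < j then f j else 0) g) :
    ConsecutivelyLinked f g := by
  obtain ⟨j, hj, h⟩ := h
  refine ⟨j, hj, fun h' => h ?_⟩
  have hk' (hjk : j = k) : f ⟨j, Nat.lt_of_succ_lt hj⟩ = 0 := by rw [← hk]; congr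
  simp only [Fin.lt_def]
  split_ifs with h1 h2 h2
  · exact h'
  · omega
  · rw [← h', hk' (by omega)]
  · simp

/-- One step of propagating `d • f = c • g` from a coordinate `x` to a neighbour `y`: it works if the
minor at `x`, `y` vanishes and neither vector is zero at `x` but nonzero at `y`. Here `fx`, `fy`,
`gx`, `gy` are the values of `f` and `g` at `x` and `y`. -/
theorem proportional_step {c d fx fy gx gy : F} (hc : c ≠ 0)
    (hm : fx * gy = fy * gx) (hf : fx = 0 → fy = 0) (hg : gx = 0 → gy = 0)
    (h : d * fx = c * gx) : d * fy = c * gy := by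
  by_cases hx : fx = 0
  · have hgx : gx = 0 := by simpa [hx, hc] using h
    rw [hf hx, hg hgx]; simp
  · refine mul_left_cancel₀ hx ?_
    linear_combination fy * h - c * hm

/-- Let `f` and `g` have interval supports, containing `k` and `k + 1` respectively. If `f` and `g`
are not linked, they are proportional: the vanishing minor at `k`, `k + 1` forces `g k ≠ 0`, and the
relation `g k • f = f k • g` spreads from `k` in both directions. -/
theorem proportional_of_not_consecutivelyLinked {f g : Fin n → F} (hf : HasIntervalSupport f)
    (hg : HasIntervalSupport g) (hfg : ¬ ConsecutivelyLinked f g) {k : ℕ} (hk : k + 1 < n)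
    (hfk : f ⟨k, Nat.lt_of_succ_lt hk⟩ ≠ 0) (hgk : g ⟨k + 1, hk⟩ ≠ 0) :
    ∃ c d : F, d ≠ 0 ∧ d • f = c • g := by
  have hm (j : ℕ) (h : j + 1 < n) : f ⟨j, Nat.lt_of_succ_lt h⟩ * g ⟨j + 1, h⟩ =
      f ⟨j + 1, h⟩ * g ⟨j, Nat.lt_of_succ_lt h⟩ := by
    by_contra h'; exact hfg ⟨j, h, h'⟩
  have hgk' : g ⟨k, Nat.lt_of_succ_lt hk⟩ ≠ 0 :=
    right_ne_zero_of_mul (hm k hk ▸ mul_ne_zero hfk hgk)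
  have up {u : Fin n → F} (hu : HasIntervalSupport u) (huk : u ⟨k, Nat.lt_of_succ_lt hk⟩ ≠ 0)
      {j : ℕ} (hkj : k ≤ j) (h : j + 1 < n) (h0 : u ⟨j, Nat.lt_of_succ_lt h⟩ = 0) :
      u ⟨j + 1, h⟩ = 0 := by
    have hne : k ≠ j := by rintro rfl; exact huk h0
    rcases hu _ h0 with h1 | h1
    · exact absurd (h1 _ (Fin.mk_lt_mk.2 (by omega))) huk
    · exact h1 _ (Fin.mk_lt_mk.2 (by omega))
  have down {u : Fin n → F} (hu : HasIntervalSupport u) (huk : u ⟨k, Nat.lt_of_succ_lt hk⟩ ≠ 0)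
      {j : ℕ} (hkj : j + 1 ≤ k) (h : j + 1 < n) (h0 : u ⟨j + 1, h⟩ = 0) :
      u ⟨j, Nat.lt_of_succ_lt h⟩ = 0 := by
    have hne : k ≠ j + 1 := by rintro rfl; exact huk h0
    rcases hu _ h0 with h1 | h1
    · exact h1 _ (Fin.mk_lt_mk.2 (by omega))
    · exact absurd (h1 _ (Fin.mk_lt_mk.2 (by omega))) huk
  refine ⟨f ⟨k, Nat.lt_of_succ_lt hk⟩, _, hgk', funext fun j => ?_⟩
  obtain ⟨j, hj⟩ := j
  simp only [Pi.smul_apply, smul_eq_mul]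
  rcases le_total k j with hkj | hjk
  · induction j, hkj using Nat.le_induction with
    | base => ring
    | succ j hkj ih =>
      exact proportional_step hfk (hm j hj) (up hf hfk hkj hj) (up hg hgk' hkj hj) (ih _)
  · induction hjk using Nat.decreasingInduction with
    | self => ring
    | of_succ j hjk ih =>
      exact proportional_step hfk (by linear_combination -hm j (by omega))
        (down hf hfk hjk (by omega)) (down hg hgk' hjk (by omega)) (ih (by omega))

/-- If all rows of a nonsingular matrix have interval supports, then any nonzero term of the
Leibniz expansion of the determinant gives an order in which consecutive rows are linked: the `i`-th
row in that order is nonzero at coordinate `i`. -/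
theorem exists_perm_linked_of_hasIntervalSupport (A : Matrix (Fin n) (Fin n) F) (hA : A.det ≠ 0)
    (hs : ∀ i, HasIntervalSupport (A i)) :
    ∃ σ : Equiv.Perm (Fin n), ∀ (i : ℕ) (h : i + 1 < n),
      ConsecutivelyLinked (A (σ ⟨i, Nat.lt_of_succ_lt h⟩)) (A (σ ⟨i + 1, h⟩)) := by
  rw [Matrix.det_apply] at hA
  obtain ⟨σ, -, hσ⟩ := Finset.exists_ne_zero_of_sum_ne_zero hA
  have hσ' : ∀ i, A (σ i) i ≠ 0 := fun i h => by
    rw [Finset.prod_eq_zero (f := fun i => A (σ i) i) (Finset.mem_univ i) h, smul_zero] at hσ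
    exact hσ rfl
  rw [← Matrix.det_apply] at hA
  refine ⟨σ, fun i h => ?_⟩
  by_contra hl
  obtain ⟨c, d, hd, hcd⟩ := proportional_of_not_consecutivelyLinked (hs _) (hs _) hl h
    (hσ' _) (hσ' _)
  have hli : LinearIndependent F A.row := Matrix.linearIndependent_rows_of_det_ne_zero hA
  have hpair := hli.comp ![σ ⟨i, Nat.lt_of_succ_lt h⟩, σ ⟨i + 1, h⟩]
    (by intro x y; fin_cases x <;> fin_cases y <;> simp [Fin.ext_iff])
  refine (linearIndependent_fin2.1 hpair).2 (d⁻¹ * c) ?_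
  change (d⁻¹ * c) • A (σ ⟨i + 1, h⟩) = A (σ ⟨i, Nat.lt_of_succ_lt h⟩)
  rw [mul_smul, ← hcd, smul_smul, inv_mul_cancel₀ hd, one_smul]

/-- The rows of a nonsingular matrix can be ordered so that consecutive rows are linked. The proof
is by induction on the number of nonzero entries: a row whose support is not an interval is the sum
of its parts on the two sides of a zero, and since the determinant is additive in that row, it stays
nonzero when the row is replaced by one of the parts. -/
theorem exists_perm_linked (A : Matrix (Fin n) (Fin n) F) (hA : A.det ≠ 0) :
    ∃ σ : Equiv.Perm (Fin n), ∀ (i : ℕ) (h : i + 1 < n),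
      ConsecutivelyLinked (A (σ ⟨i, Nat.lt_of_succ_lt h⟩)) (A (σ ⟨i + 1, h⟩)) := by
  classical
  induction hN : ∑ i, (Finset.univ.filter fun j => A i j ≠ 0).card
    using Nat.strong_induction_on generalizing A with
  | _ N ih =>
  subst hN
  by_cases hs : ∀ i, HasIntervalSupport (A i)
  · exact exists_perm_linked_of_hasIntervalSupport A hA hs
  simp only [HasIntervalSupport, not_forall, not_or] at hs
  obtain ⟨i, k, hk, ⟨l, hlk, hl⟩, ⟨r, hkr, hr⟩⟩ := hs
  -- Replacing row `i` by a part `u` of it with smaller support makes the induction hypothesis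
  -- available, as soon as the new matrix is nonsingular.
  have key (u : Fin n → F) (hu : ∀ j, u j ≠ 0 → A i j ≠ 0) (m : Fin n) (hum : u m = 0)
      (ham : A i m ≠ 0) (hlink : ∀ g, ConsecutivelyLinked u g → ConsecutivelyLinked (A i) g)
      (hdet : (A.updateRow i u).det ≠ 0) :
      ∃ σ : Equiv.Perm (Fin n), ∀ (i : ℕ) (h : i + 1 < n),
        ConsecutivelyLinked (A (σ ⟨i, Nat.lt_of_succ_lt h⟩)) (A (σ ⟨i + 1, h⟩)) := by
    have hrow (p : Fin n) (g : Fin n → F) (h : ConsecutivelyLinked (A.updateRow i u p) g) :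
        ConsecutivelyLinked (A p) g := by
      rcases eq_or_ne p i with rfl | hp
      · exact hlink g (by simpa using h)
      · rwa [Matrix.updateRow_ne hp] at h
    have hlt : ∑ p, (Finset.univ.filter fun j => A.updateRow i u p j ≠ 0).card <
        ∑ p, (Finset.univ.filter fun j => A p j ≠ 0).card := by
      refine Finset.sum_lt_sum (fun p _ => ?_) ⟨i, Finset.mem_univ i, ?_⟩
      · refine Finset.card_le_card fun j => ?_
        rcases eq_or_ne p i with rfl | hp
        · simpa using hu j
        · simp [hp]
      · refine Finset.card_lt_card ⟨fun j => by simpa using hu j, fun hsub => ?_⟩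
        have := hsub (Finset.mem_filter.2 ⟨Finset.mem_univ m, ham⟩)
        simp [hum] at this
    obtain ⟨σ, hσ⟩ := ih _ hlt (A.updateRow i u) hdet rfl
    exact ⟨σ, fun j h => (hrow _ _ (hrow _ _ (hσ j h)).symm).symm⟩
  have hsplit : A i = (fun j => if j < k then A i j else 0) +
      (fun j => if k < j then A i j else 0) := by
    funext j
    rcases lt_trichotomy j k with h | rfl | h
    · simp [h, h.le]
    · simp [hk]
    · simp [h, h.le]
  have hsum := Matrix.det_updateRow_add A i (fun j => if j < k then A i j else 0)
    (fun j => if k < j then A i j else 0)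
  rw [← hsplit, Matrix.updateRow_eq_self] at hsum
  by_cases h1 : (A.updateRow i fun j => if j < k then A i j else 0).det = 0
  · refine key (fun j => if k < j then A i j else 0) (fun j => by simp) l (by simp [hlk.le]) hl
      (fun g => .of_restrict_gt hk) ?_
    rw [h1, zero_add] at hsum
    exact hsum ▸ hA
  · exact key (fun j => if j < k then A i j else 0) (fun j => by simp) r (by simp [hkr.le]) hr
      (fun g => .of_restrict_lt hk) h1

end Linked

/-! ### Cup products of degree one classes -/

open groupCohomology in
/-- The cup product of two `1`-cocycles `a`, `b` is trivial iff `(x, y) ↦ a x * b y` is the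
coboundary of a function `h` on the group. -/
theorem CupProduct.cup_H1π_eq_zero_iff {k G : Type u} [CommRing k] [Group G]
    (a b : cocycles₁ (Rep.trivial k G k)) :
    CupProduct.cup (H1π (Rep.trivial k G k) a) (H1π (Rep.trivial k G k) b) = 0 ↔
      ∃ h : G → k, ∀ x y : G, h y - h (x * y) + h x = a x * b y := by
  rw [CupProduct.cup_H1π, H2π_eq_zero_iff]
  constructor
  · rintro ⟨h, hh⟩
    exact ⟨h, fun x y => congrFun hh (x, y)⟩
  · rintro ⟨h, hh⟩
    exact ⟨h, funext fun p => hh p.1 p.2⟩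

/-- The Heisenberg group over `R`: the triple `(a, b, c)` stands for the upper unitriangular
`3 × 3` matrix with entries `a`, `b` above the diagonal and `c` in the corner. -/
@[ext]
structure HeisenbergGroup (R : Type*) where
  a : R
  b : R
  c : R

namespace HeisenbergGroup

variable {R : Type*} [CommRing R]

instance : Mul (HeisenbergGroup R) :=
  ⟨fun x y => ⟨x.a + y.a, x.b + y.b, x.c + y.c + x.a * y.b⟩⟩

instance : One (HeisenbergGroup R) := ⟨⟨0, 0, 0⟩⟩

instance : Inv (HeisenbergGroup R) := ⟨fun x => ⟨-x.a, -x.b, -x.c + x.a * x.b⟩⟩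

@[simp] theorem mul_a (x y : HeisenbergGroup R) : (x * y).a = x.a + y.a := rfl
@[simp] theorem mul_b (x y : HeisenbergGroup R) : (x * y).b = x.b + y.b := rfl
@[simp] theorem mul_c (x y : HeisenbergGroup R) : (x * y).c = x.c + y.c + x.a * y.b := rfl
@[simp] theorem one_a : (1 : HeisenbergGroup R).a = 0 := rfl
@[simp] theorem one_b : (1 : HeisenbergGroup R).b = 0 := rfl
@[simp] theorem one_c : (1 : HeisenbergGroup R).c = 0 := rfl
@[simp] theorem inv_a (x : HeisenbergGroup R) : x⁻¹.a = -x.a := rfl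
@[simp] theorem inv_b (x : HeisenbergGroup R) : x⁻¹.b = -x.b := rfl
@[simp] theorem inv_c (x : HeisenbergGroup R) : x⁻¹.c = -x.c + x.a * x.b := rfl

instance : Group (HeisenbergGroup R) :=
  Group.ofLeftAxioms
    (fun x y z => by ext <;> simp <;> ring)
    (fun x => by ext <;> simp)
    (fun x => by ext <;> simp)

end HeisenbergGroup

/-! ### Cohomology of right-angled Artin groups -/

namespace RightAngledArtinGroup

variable {V : Type*} {Γ : SimpleGraph V}

/-- The generator of the right-angled Artin group at a vertex. -/
def of (Γ : SimpleGraph V) (v : V) : RightAngledArtinGroup Γ := PresentedGroup.of v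

theorem commute_of {v w : V} (h : Γ.Adj v w) : Commute (of Γ v) (of Γ w) := by
  have : of Γ v * of Γ w * (of Γ v)⁻¹ * (of Γ w)⁻¹ = 1 :=
    PresentedGroup.one_of_mem (rels := {r : FreeGroup V | ∃ v w : V, Γ.Adj v w ∧
      r = FreeGroup.of v * FreeGroup.of w * (FreeGroup.of v)⁻¹ * (FreeGroup.of w)⁻¹})
      ⟨v, w, h, rfl⟩
  rwa [mul_inv_eq_one, mul_inv_eq_iff_eq_mul] at this

/-- The universal property: a map from the vertices to a group under which adjacent vertices
commute extends to a homomorphism. -/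
def lift {H : Type*} [Group H] (f : V → H) (hf : ∀ v w, Γ.Adj v w → Commute (f v) (f w)) :
    RightAngledArtinGroup Γ →* H :=
  PresentedGroup.toGroup (f := f) (by
    rintro _ ⟨v, w, h, rfl⟩
    simp [(hf v w h).eq])

@[simp] theorem lift_of {H : Type*} [Group H] (f : V → H)
    (hf : ∀ v w, Γ.Adj v w → Commute (f v) (f w)) (v : V) : lift f hf (of Γ v) = f v :=
  PresentedGroup.toGroup.of _

theorem hom_ext {H : Type*} [Group H] {φ ψ : RightAngledArtinGroup Γ →* H}
    (h : ∀ v, φ (of Γ v) = ψ (of Γ v)) : φ = ψ :=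
  PresentedGroup.ext h

section Cohomology

open groupCohomology

variable {V F : Type u} [Field F] {Γ : SimpleGraph V}

/-- A `1`-cocycle with trivial coefficients, as a homomorphism to the additive group. -/
def cocycleHom (a : cocycles₁ (Rep.trivial F (RightAngledArtinGroup Γ) F)) :
    RightAngledArtinGroup Γ →* Multiplicative F :=
  MonoidHom.mk' (fun x => Multiplicative.ofAdd (a x : F))
    (fun x y => by rw [cocycles₁_map_mul_of_isTrivial]; rfl)

theorem cocycle_ext {a b : cocycles₁ (Rep.trivial F (RightAngledArtinGroup Γ) F)}
    (h : ∀ v, a (of Γ v) = b (of Γ v)) : a = b := by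
  apply cocycles₁_ext
  intro x
  have : cocycleHom a = cocycleHom b := hom_ext h
  exact DFunLike.congr_fun this x

theorem exists_H1π_eq (x : H1 (Rep.trivial F (RightAngledArtinGroup Γ) F)) :
    ∃ a, H1π (Rep.trivial F (RightAngledArtinGroup Γ) F) a = x :=
  H1_induction_on x fun a => ⟨a, rfl⟩

theorem exists_cocycle (Γ : SimpleGraph V) (f : V → F) :
    ∃ a : cocycles₁ (Rep.trivial F (RightAngledArtinGroup Γ) F), ∀ v, a (of Γ v) = f v := by
  let φ : RightAngledArtinGroup Γ →* Multiplicative F :=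
    lift (fun v => Multiplicative.ofAdd (f v)) (fun _ _ _ => Commute.all _ _)
  refine ⟨⟨fun x => (φ x).toAdd, ?_⟩, fun v => ?_⟩
  · rw [mem_cocycles₁_iff]
    intro x y
    change (φ (x * y)).toAdd = (φ y).toAdd + (φ x).toAdd
    rw [map_mul, toAdd_mul, add_comm]
  · exact congrArg Multiplicative.toAdd (lift_of _ _ v)

/-- The values on the generators are coordinates on `H¹(A(Γ), F)`. -/
noncomputable def coordinates (Γ : SimpleGraph V) :
    H1 (Rep.trivial F (RightAngledArtinGroup Γ) F) ≃ₗ[F] (V → F) :=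
  LinearEquiv.ofBijective
    (LinearMap.pi fun v =>
      { toFun := fun x => (CupProduct.cocycleOfH1 x (of Γ v) : F)
        map_add' := fun x y => by rw [map_add]; rfl
        map_smul' := fun c x => by rw [map_smul]; rfl })
    ⟨fun x y => by
      obtain ⟨a, rfl⟩ := exists_H1π_eq x
      obtain ⟨b, rfl⟩ := exists_H1π_eq y
      intro h
      refine congrArg _ (cocycle_ext fun v => ?_)
      have h' : CupProduct.cocycleOfH1 (H1π _ a) (of Γ v) =
        CupProduct.cocycleOfH1 (H1π _ b) (of Γ v) := congrFun h v
      rwa [CupProduct.cocycleOfH1_H1π, CupProduct.cocycleOfH1_H1π] at h',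
    fun f => by
      obtain ⟨a, ha⟩ := exists_cocycle Γ f
      refine ⟨H1π _ a, funext fun v => ?_⟩
      change CupProduct.cocycleOfH1 (H1π _ a) (of Γ v) = _
      rw [CupProduct.cocycleOfH1_H1π, ha]⟩

theorem coordinates_H1π (a : cocycles₁ (Rep.trivial F (RightAngledArtinGroup Γ) F)) (v : V) :
    coordinates Γ (H1π _ a) v = a (of Γ v) := by
  change CupProduct.cocycleOfH1 (H1π _ a) (of Γ v) = _
  rw [CupProduct.cocycleOfH1_H1π]

/-- If the two cocycles satisfy the condition on the edges, then `v ↦ (a v, b v, 0)` extends to a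
homomorphism to the Heisenberg group, and minus its corner entry has coboundary `a ⌣ b`. -/
theorem exists_coboundary (a b : cocycles₁ (Rep.trivial F (RightAngledArtinGroup Γ) F))
    (h : ∀ v w, Γ.Adj v w →
      (a (of Γ v) * b (of Γ w) : F) = (a (of Γ w) * b (of Γ v) : F)) :
    ∃ c : RightAngledArtinGroup Γ → F, ∀ x y, c y - c (x * y) + c x = a x * b y := by
  let φ : RightAngledArtinGroup Γ →* HeisenbergGroup F :=
    lift (fun v => ⟨a (of Γ v), b (of Γ v), 0⟩) (fun v w hvw => by
      refine HeisenbergGroup.ext (add_comm _ _) (add_comm _ _) ?_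
      exact congrArg (fun t : F => 0 + 0 + t) (h v w hvw))
  have hφ (v : V) : φ (of Γ v) = ⟨a (of Γ v), b (of Γ v), 0⟩ := lift_of _ _ v
  have ha (x : RightAngledArtinGroup Γ) : (φ x).a = a x := by
    let ψ : RightAngledArtinGroup Γ →* Multiplicative F :=
      MonoidHom.mk' (fun x => Multiplicative.ofAdd (φ x).a) (fun x y => by rw [map_mul]; rfl)
    have : ψ = cocycleHom a := hom_ext fun v => congrArg HeisenbergGroup.a (hφ v)
    exact DFunLike.congr_fun this x
  have hb (x : RightAngledArtinGroup Γ) : (φ x).b = b x := by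
    let ψ : RightAngledArtinGroup Γ →* Multiplicative F :=
      MonoidHom.mk' (fun x => Multiplicative.ofAdd (φ x).b) (fun x y => by rw [map_mul]; rfl)
    have : ψ = cocycleHom b := hom_ext fun v => congrArg HeisenbergGroup.b (hφ v)
    exact DFunLike.congr_fun this x
  refine ⟨fun x => -(φ x).c, fun x y => ?_⟩
  simp only [← ha, ← hb, map_mul, HeisenbergGroup.mul_c]
  ring

/-- The cup product of two classes vanishes iff all their `2 × 2` minors on the edges of the graph
vanish. -/
theorem cup_eq_zero_iff (x y : H1 (Rep.trivial F (RightAngledArtinGroup Γ) F)) :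
    CupProduct.cup x y = 0 ↔ ∀ v w, Γ.Adj v w →
      coordinates Γ x v * coordinates Γ y w = coordinates Γ x w * coordinates Γ y v := by
  obtain ⟨a, rfl⟩ := exists_H1π_eq x
  obtain ⟨b, rfl⟩ := exists_H1π_eq y
  rw [CupProduct.cup_H1π_eq_zero_iff]
  constructor
  · rintro ⟨h, hh⟩ v w hvw
    rw [coordinates_H1π, coordinates_H1π, coordinates_H1π, coordinates_H1π]
    have h1 := hh (of Γ v) (of Γ w)
    have h2 := hh (of Γ w) (of Γ v)
    rw [← (commute_of hvw).eq] at h2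
    linear_combination h2 - h1
  · intro h
    refine exists_coboundary a b fun v w hvw => ?_
    have := h v w hvw
    rwa [coordinates_H1π, coordinates_H1π, coordinates_H1π, coordinates_H1π] at this

end Cohomology

end RightAngledArtinGroup

/-! ### Hamiltonian paths as enumerations of the vertices -/

theorem SimpleGraph.exists_isHamiltonian_iff {V : Type*} [Finite V] [Nonempty V] [DecidableEq V]
    (Γ : SimpleGraph V) :
    (∃ (a b : V) (p : Γ.Walk a b), p.IsHamiltonian) ↔
      ∃ e : Fin (Nat.card V) ≃ V, ∀ (i : ℕ) (h : i + 1 < Nat.card V),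
        Γ.Adj (e ⟨i, Nat.lt_of_succ_lt h⟩) (e ⟨i + 1, h⟩) := by
  constructor
  · rintro ⟨a, b, p, hp⟩
    have hcard : p.support.length = Nat.card V := by
      simpa using Nat.card_congr hp.supportGetEquiv
    refine ⟨(finCongr hcard.symm).trans hp.supportGetEquiv, fun i h => ?_⟩
    exact p.isChain_adj_support.getElem i (hcard ▸ h)
  · rintro ⟨e, he⟩
    have hne : List.ofFn e ≠ [] := by
      rw [Ne, List.ofFn_eq_nil_iff]
      exact Nat.card_pos.ne'
    have hchain : (List.ofFn e).IsChain Γ.Adj := by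
      rw [List.isChain_iff_getElem]
      intro i h
      simpa using he i (by simpa using h)
    refine ⟨_, _, .ofSupport _ hne hchain, fun v => ?_⟩
    rw [Walk.support_ofSupport]
    exact List.count_eq_one_of_mem (List.nodup_ofFn.2 e.injective)
      (by rw [List.mem_ofFn]; exact e.surjective v)

/-! ### The equivalence -/

/-- The coordinate vectors of two nonadjacent vertices have no nonzero minor on an edge. -/
theorem SimpleGraph.single_minor_eq_zero {V F : Type*} [DecidableEq V] [Field F]
    {Γ : SimpleGraph V} {p q v w : V} (hpq : ¬ Γ.Adj p q) (hvw : Γ.Adj v w) :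
    (Pi.single p 1 : V → F) v * (Pi.single q 1 : V → F) w =
      (Pi.single p 1 : V → F) w * (Pi.single q 1 : V → F) v := by
  have h1 : ¬ (v = p ∧ w = q) := by rintro ⟨rfl, rfl⟩; exact hpq hvw
  have h2 : ¬ (w = p ∧ v = q) := by rintro ⟨rfl, rfl⟩; exact hpq hvw.symm
  simp only [Pi.single_apply]
  grind

theorem theorem1p1 {V F : Type u} [Finite V] [Nonempty V] [DecidableEq V] [Field F]
    (Γ : SimpleGraph V) :
    (∃ (a b : V) (p : Γ.Walk a b), p.IsHamiltonian) ↔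
      IsHamiltonianPairing
        (CupProduct.cup (k := F) (G := RightAngledArtinGroup Γ)) := by
  have := Fintype.ofFinite V
  rw [SimpleGraph.exists_isHamiltonian_iff]
  let L := RightAngledArtinGroup.coordinates (F := F) Γ
  constructor
  · rintro ⟨e, he⟩
    refine ⟨Module.Finite.equiv L.symm, fun n w => ?_⟩
    obtain rfl : n = Nat.card V := by
      rw [Nat.card_eq_fintype_card, ← Module.finrank_fintype_fun_eq_card F,
        Module.finrank_eq_card_basis (w.map L), Fintype.card_fin]
    -- The rows are the given basis vectors, the columns their coordinates along the path.
    let A : Matrix (Fin (Nat.card V)) (Fin (Nat.card V)) F := fun i j => L (w i) (e j)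
    have hA : LinearIndependent F A.row :=
      (w.map (L.trans (LinearEquiv.funCongrLeft F F e))).linearIndependent
    have hdet : A.det ≠ 0 :=
      ((Matrix.isUnit_iff_isUnit_det A).1 (Matrix.linearIndependent_rows_iff_isUnit.1 hA)).ne_zero
    obtain ⟨σ, hσ⟩ := exists_perm_linked A hdet
    refine ⟨σ, fun i h h0 => ?_⟩
    obtain ⟨j, hj, hne⟩ := hσ i h
    exact hne ((RightAngledArtinGroup.cup_eq_zero_iff _ _).1 h0 _ _ (he j hj))
  · rintro ⟨-, hq⟩
    let e := Finite.equivFin V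
    obtain ⟨σ, hσ⟩ := hq _ (((Pi.basisFun F V).map L.symm).reindex e)
    refine ⟨σ.trans e.symm, fun i h => ?_⟩
    by_contra hadj
    refine hσ i h ((RightAngledArtinGroup.cup_eq_zero_iff _ _).2 fun v w hvw => ?_)
    have hL (x : V → F) : RightAngledArtinGroup.coordinates Γ (L.symm x) = x := L.apply_symm_apply x
    simp only [Module.Basis.reindex_apply, Module.Basis.map_apply, Pi.basisFun_apply, hL]
    exact SimpleGraph.single_minor_eq_zero hadj hvw
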